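/- Let $X$ and $X_n$, $n\in\mathbb N$, be complex Banach spaces, and let $P_n:X\to X_n$ and $E_n:X_n\to X$ be bounded linear operators with $\sup_n\|P_n\|<\infty$, $\sup_n\|E_n\|<\infty$ and $P_nE_n=\mathrm{Id}_{X_n}$ for every $n$. Let $M\ge 1$ and $\omega\in\mathbb R$, and for every $n$ let $A_n$ be the generator of a $C_0$-semigroup $(T_n(t))_{t\ge0}$ on $X_n$ with $\|T_n(t)\|\le Me^{\omega t}$ for all $t\ge0$. Write $\rho(A_n)$ for the resolvent set of $A_n$ and $R(\lambda,A_n)=(\lambda-A_n)^{-1}$ for $\lambda\in\rho(A_n)$. Then the following statements are equivalent. (a) There exist $\lambda_0\in\bigcap_{n\in\mathbb N}\rho(A_n)$ with $\operatorname{Re}\lambda_0>\omega$ and a bounded linear operator $R$ on $X$ with dense range such that for all $x\in X$ \[\lim_{n\to\infty}\|E_nR(\lambda_0,A_n)P_nx-Rx\|=0.\] (b) There exists a $C_0$-semigroup $(T(t))_{t\ge0}$ on $X$ such that for every $x\in X$ \[\lim_{n\to\infty}\|E_nT_n(t)P_nx-T(t)x\|=0\] uniformly for $t$ in bounded subintervals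 of $[0,\infty)$. -/

import Mathlib

open Filter Topology

noncomputable section

namespace TrotterKato

variable {X : Type*} [NormedAddCommGroup X] [NormedSpace ℂ X]

/-- `(T(t))_{t ≥ 0}` is a strongly continuous one-parameter semigroup (a `C₀`-semigroup) of bounded
linear operators on `X`. Only the values `T t` with `0 ≤ t` are constrained (and ever used). -/
structure IsC0Semigroup (T : ℝ → X →L[ℂ] X) : Prop where
  map_zero : T 0 = ContinuousLinearMap.id ℂ X
  map_add : ∀ t s : ℝ, 0 ≤ t → 0 ≤ s → T (t + s) = (T t).comp (T s)
  tendsto_zero : ∀ f : X, Tendsto (fun t : ℝ => T t f) (𝓝[>] 0) (𝓝 f)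

/-- The (unbounded) operator `A` with domain `A.domain` is the generator of `T`: its domain consists
of the `x` for which `lim_{t ↘ 0} (T(t)x - x) / t` exists, and `A x` is that limit. -/
structure IsGenerator (A : X →ₗ.[ℂ] X) (T : ℝ → X →L[ℂ] X) : Prop where
  mem_domain_iff : ∀ x : X, x ∈ A.domain ↔
    ∃ y : X, Tendsto (fun t : ℝ => t⁻¹ • (T t x - x)) (𝓝[>] 0) (𝓝 y)
  tendsto_apply : ∀ x : A.domain,
    Tendsto (fun t : ℝ => t⁻¹ • (T t (x : X) - (x : X))) (𝓝[>] 0) (𝓝 (A x))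

/-- The class `𝒢(M, ω, X)` of the operators on `X` that generate a `C₀`-semigroup `T` with
`‖T(t)‖ ≤ M e^{ω t}` for all `t ≥ 0`, where `M ≥ 1` and `ω` is real. -/
def GeneratorClass (M ω : ℝ) (X : Type*) [NormedAddCommGroup X] [NormedSpace ℂ X] :
    Set (X →ₗ.[ℂ] X) :=
  {A | 1 ≤ M ∧ ∃ T : ℝ → X →L[ℂ] X, IsC0Semigroup T ∧ IsGenerator A T ∧
    ∀ t : ℝ, 0 ≤ t → ‖T t‖ ≤ M * Real.exp (ω * t)}

/-- The bounded operator `R` is a two-sided inverse of `z - A : A.domain → X`. -/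
structure IsResolventAt (A : X →ₗ.[ℂ] X) (z : ℂ) (R : X →L[ℂ] X) : Prop where
  right_inv : ∀ x : X, ∃ h : R x ∈ A.domain, z • R x - A ⟨R x, h⟩ = x
  left_inv : ∀ x : A.domain, R (z • (x : X) - A x) = x

/-- The resolvent set `ρ(A)`. -/
def resolventSet (A : X →ₗ.[ℂ] X) : Set ℂ :=
  {z | ∃ R : X →L[ℂ] X, IsResolventAt A z R}

open Classical in
/-- The resolvent operator `R(z, A) = (z - A)⁻¹` for `z ∈ ρ(A)`, and `0` for other `z`. -/
def resolvent (z : ℂ) (A : X →ₗ.[ℂ] X) : X →L[ℂ] X :=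
  if h : ∃ R : X →L[ℂ] X, IsResolventAt A z R then h.choose else 0

end TrotterKato

end

/-! Write `L_n(z)` for the resolvent of `A_n`, which for `Re z > ω` is the Laplace transform of
`T_n`.

(b) ⇒ (a): the limit semigroup inherits a growth bound with the same `ω`. Dominated convergence
under the Laplace integral gives convergence of the resolvents to the Laplace transform of `T`,
whose range contains the domain of the generator of `T` and so is dense.

(a) ⇒ (b): the limit is built without first finding its generator. `T_n` is compared with the
implicit Euler scheme `F_n = s⁻¹ L_n(s⁻¹)`. On vectors of `D(A_n²)` the error is `O(s)`, uniformly
in `n` and in `t ∈ [0, b]`, because powers of `F_n` are bounded independently of `n` and `s`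
(`norm_eulerStep_pow_le`, `norm_sub_eulerStep_pow_floor_le`). For fixed `s` only finitely many
powers matter on `[0, b]`, and each converges as `n → ∞`, since resolvent convergence spreads from
`λ₀` to the whole half-plane (`ResolventConverges.of_lt_re`). Hence orbits starting in the range of
`R²` are uniformly Cauchy (`orbitApproximable_sq`). That range is dense and the operators are
uniformly bounded, so all orbits converge. As `P_n E_n = 1`, products pass to the limit and the
semigroup law survives. -/

namespace TrotterKato

open Set MeasureTheory

/-! ### C₀-semigroups: local bounds, orbits and generators. -/

section Basic

variable {X Y : Type*} [NormedAddCommGroup X] [NormedSpace ℂ X]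
  [NormedAddCommGroup Y] [NormedSpace ℂ Y]

/-- A strongly convergent, eventually bounded family of operators may be applied to a convergent
family of vectors. -/
theorem tendsto_apply_of_norm_le {ι : Type*} {l : Filter ι} {F : ι → X →L[ℂ] Y} {u : ι → X}
    {u₀ : X} {v : Y} {C : ℝ} (hb : ∀ᶠ i in l, ‖F i‖ ≤ C)
    (hF : Tendsto (fun i => F i u₀) l (𝓝 v)) (hu : Tendsto u l (𝓝 u₀)) :
    Tendsto (fun i => F i (u i)) l (𝓝 v) := by
  have h0 : Tendsto (fun i => F i (u i - u₀)) l (𝓝 0) := by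
    have h1 : Tendsto (fun i => C * ‖u i - u₀‖) l (𝓝 0) := by
      simpa using (tendsto_iff_norm_sub_tendsto_zero.1 hu).const_mul C
    refine squeeze_zero_norm' ?_ h1
    filter_upwards [hb] with i hi
    exact (F i).le_of_opNorm_le hi _
  simpa using h0.add hF

/-- `y` lies in the domain of the generator of `T`, whose value at `y` is `z`. -/
def HasGeneratorValue (T : ℝ → X →L[ℂ] X) (y z : X) : Prop :=
  Tendsto (fun t : ℝ => t⁻¹ • (T t y - y)) (𝓝[>] 0) (𝓝 z)

namespace IsC0Semigroup

variable {T : ℝ → X →L[ℂ] X}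

theorem apply_add (hT : IsC0Semigroup T) {t s : ℝ} (ht : 0 ≤ t) (hs : 0 ≤ s) (x : X) :
    T (t + s) x = T t (T s x) := by
  rw [hT.map_add t s ht hs]; rfl

theorem apply_comm (hT : IsC0Semigroup T) {t s : ℝ} (ht : 0 ≤ t) (hs : 0 ≤ s) (x : X) :
    T t (T s x) = T s (T t x) := by
  rw [← hT.apply_add ht hs, ← hT.apply_add hs ht, add_comm]

theorem apply_zero (hT : IsC0Semigroup T) (x : X) : T 0 x = x := by
  rw [hT.map_zero]; rfl

theorem tendsto_Ici (hT : IsC0Semigroup T) (x : X) :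
    Tendsto (fun t : ℝ => T t x) (𝓝[≥] 0) (𝓝 x) := by
  have h : ContinuousWithinAt (fun t : ℝ => T t x) (Ioi 0) 0 := by
    simpa [ContinuousWithinAt, hT.apply_zero] using hT.tendsto_zero x
  simpa [ContinuousWithinAt, hT.apply_zero] using continuousWithinAt_Ioi_iff_Ici.1 h

/-- Otherwise some `t_k → 0` would have `‖T (t_k)‖ > k`, against Banach–Steinhaus for the pointwise
convergent sequence `T (t_k)`. -/
theorem exists_norm_le_near_zero [CompleteSpace X] (hT : IsC0Semigroup T) :
    ∃ δ > 0, ∃ C, ∀ t ∈ Icc (0 : ℝ) δ, ‖T t‖ ≤ C := by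
  by_contra! hcon
  choose t ht hlt using fun k : ℕ => hcon (1 / ((k : ℝ) + 1)) (by positivity) k
  have htz : Tendsto t atTop (𝓝[≥] 0) := by
    refine tendsto_nhdsWithin_iff.2 ⟨?_, Eventually.of_forall fun k => (ht k).1⟩
    exact squeeze_zero (fun k => (ht k).1) (fun k => (ht k).2) tendsto_one_div_add_atTop_nhds_zero_nat
  obtain ⟨C, hC⟩ := banach_steinhaus (g := fun k => T (t k)) fun x => by
    obtain ⟨C, hC⟩ := (((hT.tendsto_Ici x).comp htz).norm).bddAbove_range
    exact ⟨C, fun i => hC ⟨i, rfl⟩⟩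
  obtain ⟨k, hk⟩ := exists_nat_gt C
  linarith [hC k, hlt k]

theorem exists_norm_le [CompleteSpace X] (hT : IsC0Semigroup T) (b : ℝ) :
    ∃ C, ∀ t ∈ Icc (0 : ℝ) b, ‖T t‖ ≤ C := by
  obtain ⟨δ, hδ, C, hC⟩ := hT.exists_norm_le_near_zero
  have key : ∀ k : ℕ, ∃ D, ∀ t ∈ Icc (0 : ℝ) (k * δ), ‖T t‖ ≤ D := by
    intro k
    induction k with
    | zero =>
      refine ⟨‖T 0‖, fun t ht => ?_⟩
      have : t = 0 := le_antisymm (by simpa using ht.2) ht.1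
      rw [this]
    | succ k ih =>
      obtain ⟨D, hD⟩ := ih
      refine ⟨max C (C * D), fun t ht => ?_⟩
      rcases le_total t δ with h | h
      · exact (hC t ⟨ht.1, h⟩).trans (le_max_left _ _)
      · refine le_trans ?_ (le_max_right _ _)
        have h2 := ht.2
        push_cast at h2
        have e : t = δ + (t - δ) := by ring
        rw [e, hT.map_add _ _ hδ.le (by linarith)]
        refine (ContinuousLinearMap.opNorm_comp_le _ _).trans ?_
        have h1 := hC δ ⟨hδ.le, le_rfl⟩
        exact mul_le_mul h1 (hD _ ⟨by linarith, by linarith⟩) (norm_nonneg _)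
          ((norm_nonneg _).trans h1)
  obtain ⟨k, hk⟩ := exists_nat_ge (b / δ)
  obtain ⟨D, hD⟩ := key k
  exact ⟨D, fun t ht => hD t ⟨ht.1, ht.2.trans ((div_le_iff₀ hδ).1 hk)⟩⟩

theorem continuousOn [CompleteSpace X] (hT : IsC0Semigroup T) (x : X) :
    ContinuousOn (fun t => T t x) (Ici 0) := by
  intro t₀ ht₀
  obtain ⟨C, hC⟩ := hT.exists_norm_le (t₀ + 1)
  -- Factoring out the earlier time treats left and right continuity alike; on the left the local
  -- norm bound is essential.
  have hle : ∀ s t, 0 ≤ s → s ≤ t → t ≤ t₀ + 1 → ‖T t x - T s x‖ ≤ C * ‖T (t - s) x - x‖ := by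
    intro s t hs hst ht
    have e : T t x - T s x = T s (T (t - s) x - x) := by
      rw [map_sub, ← hT.apply_add hs (by linarith)]; simp
    rw [e]
    exact (T s).le_of_opNorm_le (hC s ⟨hs, by linarith⟩) _
  have h1 : Tendsto (fun t : ℝ => |t - t₀|) (𝓝[Ici 0] t₀) (𝓝[≥] 0) := by
    refine tendsto_nhdsWithin_iff.2 ⟨?_, Eventually.of_forall fun k => mem_Ici.2 (abs_nonneg _)⟩
    have : Continuous fun t : ℝ => |t - t₀| := by fun_prop
    simpa using (this.tendsto t₀).mono_left nhdsWithin_le_nhds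
  have h2 : Tendsto (fun t : ℝ => C * ‖T |t - t₀| x - x‖) (𝓝[Ici 0] t₀) (𝓝 0) := by
    simpa using (tendsto_iff_norm_sub_tendsto_zero.1 ((hT.tendsto_Ici x).comp h1)).const_mul C
  refine tendsto_iff_norm_sub_tendsto_zero.2 (squeeze_zero' (Eventually.of_forall fun _ => norm_nonneg _) ?_ h2)
  have h3 : ∀ᶠ t in 𝓝[Ici 0] t₀, t < t₀ + 1 :=
    mem_nhdsWithin_of_mem_nhds (Iio_mem_nhds (by linarith))
  filter_upwards [h3, self_mem_nhdsWithin] with t ht ht0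
  rcases le_total t₀ t with h | h
  · rw [abs_of_nonneg (by linarith)]
    exact hle _ _ ht₀ h ht.le
  · rw [abs_of_nonpos (by linarith), norm_sub_rev, neg_sub]
    exact hle _ _ ht0 h (by linarith)

/-- `T` is arbitrary at negative times; truncating the time gives an integrand continuous on all of
`ℝ`, as the fundamental theorem of calculus at `0` requires. -/
theorem continuous_max [CompleteSpace X] (hT : IsC0Semigroup T) (x : X) :
    Continuous (fun t => T (max t 0) x) :=
  (hT.continuousOn x).comp_continuous (by fun_prop) fun t => le_max_right t 0

theorem hasGeneratorValue_apply (hT : IsC0Semigroup T) {y z : X} (h : HasGeneratorValue T y z)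
    {t : ℝ} (ht : 0 ≤ t) : HasGeneratorValue T (T t y) (T t z) := by
  refine (((T t).continuous.tendsto z).comp h).congr' ?_
  filter_upwards [self_mem_nhdsWithin] with s hs
  simp [hT.apply_comm ht (le_of_lt hs)]

theorem hasDerivWithinAt (hT : IsC0Semigroup T) {y z : X} (h : HasGeneratorValue T y z)
    {t : ℝ} (ht : 0 ≤ t) : HasDerivWithinAt (fun s => T s y) (T t z) (Ici t) t := by
  rw [← hasDerivWithinAt_Ioi_iff_Ici, hasDerivWithinAt_iff_tendsto_slope' (by simp)]
  have h1 : Tendsto (fun s : ℝ => s - t) (𝓝[>] t) (𝓝[>] 0) := by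
    refine tendsto_nhdsWithin_iff.2 ⟨?_, ?_⟩
    · have : Continuous fun s : ℝ => s - t := by fun_prop
      simpa using (this.tendsto t).mono_left nhdsWithin_le_nhds
    · filter_upwards [self_mem_nhdsWithin] with s hs
      simpa using hs
  refine ((hT.hasGeneratorValue_apply h ht).comp h1).congr' ?_
  filter_upwards [self_mem_nhdsWithin] with s hs
  have hs' : t < s := hs
  simp only [Function.comp, slope, vsub_eq_sub]
  rw [← hT.apply_add (by linarith) ht]
  simp

/-- Orbits of vectors in the domain of the generator are Lipschitz continuous. -/
theorem norm_apply_sub_apply_le [CompleteSpace X] (hT : IsC0Semigroup T) {y z : X}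
    (h : HasGeneratorValue T y z) {K s t : ℝ} (hK : ∀ r ∈ Icc (0 : ℝ) t, ‖T r‖ ≤ K) (hs : 0 ≤ s)
    (hst : s ≤ t) : ‖T t y - T s y‖ ≤ K * ‖z‖ * (t - s) :=
  norm_image_sub_le_of_norm_deriv_right_le_segment (f := fun r => T r y) (f' := fun r => T r z)
    ((hT.continuousOn y).mono fun _ hr => hs.trans hr.1)
    (fun _ hr => hT.hasDerivWithinAt h (hs.trans hr.1))
    (fun r hr => (T r).le_of_opNorm_le (hK r ⟨hs.trans hr.1, hr.2.le⟩) _) t ⟨hst, le_rfl⟩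

/-- First-order Taylor estimate for the orbit of a vector in the domain of the square of the
generator. -/
theorem norm_taylor_le [CompleteSpace X] (hT : IsC0Semigroup T) {y a c : X}
    (hy : HasGeneratorValue T y a) (ha : HasGeneratorValue T a c) {K t : ℝ} (ht : 0 ≤ t)
    (hK : ∀ r ∈ Icc (0 : ℝ) t, ‖T r‖ ≤ K) :
    ‖T t y - y - t • a‖ ≤ K * ‖c‖ * t ^ 2 := by
  have hK0 : 0 ≤ K := (norm_nonneg _).trans (hK 0 ⟨le_rfl, ht⟩)
  have := norm_image_sub_le_of_norm_deriv_right_le_segment (f := fun r => T r y - r • a)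
    (f' := fun r => T r a - (1 : ℝ) • a) (C := K * ‖c‖ * t)
    (((hT.continuousOn y).mono fun _ hr => hr.1).sub (by fun_prop))
    (fun r hr => (hT.hasDerivWithinAt hy hr.1).sub ((hasDerivWithinAt_id _ _).smul_const a))
    (fun r hr => by
      have h1 := hT.norm_apply_sub_apply_le ha (K := K) (s := 0) (t := r)
        (fun q hq => hK q ⟨hq.1, hq.2.trans hr.2.le⟩) le_rfl hr.1
      rw [hT.apply_zero, sub_zero] at h1
      rw [one_smul]
      refine h1.trans ?_
      have := hr.2.le
      gcongr) t ⟨ht, le_rfl⟩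
  simp only [hT.apply_zero, zero_smul, sub_zero] at this
  calc ‖T t y - y - t • a‖ = ‖T t y - t • a - y‖ := by congr 1; abel
    _ ≤ _ := this
    _ = _ := by ring

/-- Applying `T r` slides the window of integration from `[0, h]` to `[r, r + h]`, so the difference
quotient is the slope of the sliding-window integral at `r = 0`. -/
theorem hasGeneratorValue_integral [CompleteSpace X] (hT : IsC0Semigroup T) (x : X) {h : ℝ}
    (hh : 0 ≤ h) :
    HasGeneratorValue T (∫ s in (0 : ℝ)..h, T (max s 0) x) (T h x - x) := by
  set g : ℝ → X := fun s => T (max s 0) x with hg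
  have hc : Continuous g := hT.continuous_max x
  have hd : HasDerivAt (fun r => ∫ s in r..(r + h), g s) (g h - g 0) 0 := by
    have h0 : ∀ r, (∫ s in r..(r + h), g s) = (∫ s in (0:ℝ)..(r + h), g s) - ∫ s in (0:ℝ)..r, g s :=
      fun r => by
        rw [eq_sub_iff_add_eq, add_comm, intervalIntegral.integral_add_adjacent_intervals] <;>
        exact hc.intervalIntegrable _ _
    simp_rw [h0]
    have hI : ∀ b, HasDerivAt (fun r => ∫ s in (0:ℝ)..r, g s) (g b) b := fun b =>
      hc.integral_hasStrictDerivAt 0 b |>.hasDerivAt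
    refine HasDerivAt.sub ?_ (hI 0)
    have := (hI (0 + h)).comp_add_const 0 h
    simpa using this
  have hd' : HasDerivWithinAt (fun r => ∫ s in r..(r + h), g s) (g h - g 0) (Ioi 0) 0 :=
    hd.hasDerivWithinAt
  rw [hasDerivWithinAt_iff_tendsto_slope' (by simp)] at hd'
  have e : g h - g 0 = T h x - x := by simp [hg, hh, hT.apply_zero]
  rw [e] at hd'
  refine hd'.congr' ?_
  filter_upwards [self_mem_nhdsWithin] with r hr
  have hr : 0 < r := hr
  simp only [slope, vsub_eq_sub, sub_zero, zero_add]
  congr 2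
  rw [← ContinuousLinearMap.intervalIntegral_comp_comm _ (hc.intervalIntegrable _ _)]
  have : ∀ s ∈ uIcc 0 h, T r (g s) = g (s + r) := by
    intro s hs
    rw [uIcc_of_le hh] at hs
    have hs0 : 0 ≤ s := hs.1
    simp only [hg]
    rw [max_eq_left hs0, max_eq_left (by linarith), ← hT.apply_add hr.le hs0, add_comm]
  rw [intervalIntegral.integral_congr this, intervalIntegral.integral_comp_add_right]
  simp [add_comm]

/-- The domain of the generator is dense. -/
theorem dense_hasGeneratorValue [CompleteSpace X] (hT : IsC0Semigroup T) :
    Dense {y : X | ∃ z, HasGeneratorValue T y z} := by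
  intro x
  have hc : Continuous fun s => T (max s 0) x := hT.continuous_max x
  have hd : HasDerivWithinAt (fun r => ∫ s in (0:ℝ)..r, T (max s 0) x) (T (max 0 0) x) (Ioi 0) 0 :=
    (hc.integral_hasStrictDerivAt 0 0).hasDerivAt.hasDerivWithinAt
  rw [hasDerivWithinAt_iff_tendsto_slope' (by simp)] at hd
  simp only [max_self, hT.apply_zero] at hd
  refine mem_closure_of_tendsto hd ?_
  filter_upwards [self_mem_nhdsWithin] with r hr
  refine ⟨r⁻¹ • (T r x - x), ?_⟩
  have := (hT.hasGeneratorValue_integral x (le_of_lt hr)).const_smul r⁻¹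
  refine this.congr fun t => ?_
  simp [slope, smul_sub, smul_comm t⁻¹ r⁻¹]

/-- A semigroup is determined by its generator. -/
theorem eq_of_generator [CompleteSpace X] {S : ℝ → X →L[ℂ] X} (hT : IsC0Semigroup T)
    (hS : IsC0Semigroup S) (h : ∀ y z, HasGeneratorValue T y z → HasGeneratorValue S y z) {t : ℝ}
    (ht : 0 ≤ t) : T t = S t := by
  obtain ⟨C, hC⟩ := hS.exists_norm_le t
  refine ContinuousLinearMap.coeFn_injective
    ((T t).continuous.ext_on hT.dense_hasGeneratorValue (S t).continuous ?_)
  rintro x ⟨z, hz⟩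
  -- This path joins `S t x` to `T t x`. Its right derivative vanishes because the two generator
  -- terms cancel, so it is constant.
  have hcont : ContinuousOn (fun s => S (t - s) (T s x)) (Icc 0 t) := by
    intro s hs
    refine tendsto_apply_of_norm_le (C := C) ?_ ?_
      ((hT.continuousOn x).mono (fun _ hr => hr.1) s hs)
    · filter_upwards [self_mem_nhdsWithin] with r hr
      exact hC _ ⟨by linarith [hr.2], by linarith [hr.1]⟩
    · have : ContinuousOn (fun r => S (t - r) (T s x)) (Icc 0 t) :=
        (hS.continuousOn (T s x)).comp (by fun_prop) fun r hr => by simpa using hr.2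
      exact this s hs
  have := constant_of_has_deriv_right_zero hcont fun s hs => by
    rw [← hasDerivWithinAt_Ioi_iff_Ici, hasDerivWithinAt_iff_tendsto_slope' (by simp)]
    have h1 : Tendsto (fun r : ℝ => r - s) (𝓝[>] s) (𝓝[>] 0) := by
      refine tendsto_nhdsWithin_iff.2 ⟨?_, ?_⟩
      · have : Continuous fun r : ℝ => r - s := by fun_prop
        simpa using (this.tendsto s).mono_left nhdsWithin_le_nhds
      · filter_upwards [self_mem_nhdsWithin] with r hr
        simpa using hr
    have hTy := hT.hasGeneratorValue_apply hz hs.1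
    have hlim : Tendsto (fun r : ℝ => (r - s)⁻¹ • (T (r - s) (T s x) - T s x)
        - (r - s)⁻¹ • (S (r - s) (T s x) - T s x)) (𝓝[>] s) (𝓝 0) := by
      rw [← sub_self (T s z)]
      exact (hTy.sub (h _ _ hTy)).comp h1
    have hlt : ∀ᶠ r in 𝓝[>] s, r < t := mem_nhdsWithin_of_mem_nhds (Iio_mem_nhds hs.2)
    have hb : ∀ᶠ r in 𝓝[>] s, ‖S (t - r)‖ ≤ C := by
      filter_upwards [hlt, self_mem_nhdsWithin] with r hr hr'
      have hr' : s < r := hr'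
      exact hC _ ⟨by linarith, by linarith [hs.1]⟩
    refine (tendsto_apply_of_norm_le hb (v := 0) (by simp) hlim).congr' ?_
    filter_upwards [hlt, self_mem_nhdsWithin] with r hr hr'
    have hr' : s < r := hr'
    rw [← smul_sub, sub_sub_sub_cancel_right, ← hT.apply_add (by linarith) hs.1,
      (S (t - r)).map_smul_of_tower, map_sub, ← hS.apply_add (by linarith) (by linarith)]
    simp [slope]
  have := this t ⟨ht, le_rfl⟩
  simpa [hS.apply_zero, hT.apply_zero] using this

end IsC0Semigroup

end Basic

/-! ### The resolvent as a Laplace transform. -/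

section Laplace

variable {X : Type*} [NormedAddCommGroup X] [NormedSpace ℂ X] {M ω : ℝ} {z : ℂ}

/-- The exponential growth bound `‖T(t)‖ ≤ M e^{ω t}` for `t ≥ 0`. -/
def HasGrowthBound (T : ℝ → X →L[ℂ] X) (M ω : ℝ) : Prop :=
  ∀ t : ℝ, 0 ≤ t → ‖T t‖ ≤ M * Real.exp (ω * t)

theorem norm_cexp_smul_le {v : X} {c s : ℝ} (h : ‖v‖ ≤ c * Real.exp (ω * s)) :
    ‖Complex.exp (-z * s) • v‖ ≤ c * Real.exp ((ω - z.re) * s) := by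
  have e : ‖Complex.exp (-z * s)‖ = Real.exp (-z.re * s) := by
    rw [Complex.norm_exp]; simp
  rw [norm_smul, e]
  calc Real.exp (-z.re * s) * ‖v‖ ≤ Real.exp (-z.re * s) * (c * Real.exp (ω * s)) := by gcongr
    _ = c * (Real.exp (-z.re * s) * Real.exp (ω * s)) := by ring
    _ = _ := by rw [← Real.exp_add]; ring_nf

theorem norm_integral_cexp_smul_le {u : ℝ → X} {c : ℝ} (hz : ω < z.re)
    (h : ∀ s, 0 ≤ s → ‖u s‖ ≤ c * Real.exp (ω * s)) :
    ‖∫ s in Ioi (0 : ℝ), Complex.exp (-z * s) • u s‖ ≤ c / (z.re - ω) := by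
  have hneg : ω - z.re < 0 := by linarith
  have hi : IntegrableOn (fun s => c * Real.exp ((ω - z.re) * s)) (Ioi 0) :=
    (integrableOn_exp_mul_Ioi hneg 0).const_mul c
  refine (norm_integral_le_of_norm_le hi ?_).trans_eq ?_
  · filter_upwards [ae_restrict_mem measurableSet_Ioi] with s hs
    exact norm_cexp_smul_le (h s (le_of_lt hs))
  · rw [integral_const_mul, integral_exp_mul_Ioi hneg]
    simp only [mul_zero, Real.exp_zero]
    rw [← neg_sub z.re ω, neg_div_neg_eq, mul_one_div]

namespace IsC0Semigroup

variable {T : ℝ → X →L[ℂ] X}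

theorem norm_apply_le (hb : HasGrowthBound T M ω) (x : X) {t : ℝ} (ht : 0 ≤ t) :
    ‖T t x‖ ≤ M * ‖x‖ * Real.exp (ω * t) :=
  ((T t).le_of_opNorm_le (hb t ht) x).trans_eq (by ring)

variable [CompleteSpace X]

theorem integrableOn_cexp_smul (hT : IsC0Semigroup T) (hb : HasGrowthBound T M ω)
    (hz : ω < z.re) (x : X) :
    IntegrableOn (fun s : ℝ => Complex.exp (-z * s) • T s x) (Ioi 0) := by
  have hi : IntegrableOn (fun s => M * ‖x‖ * Real.exp ((ω - z.re) * s)) (Ioi 0) :=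
    (integrableOn_exp_mul_Ioi (by linarith) 0).const_mul _
  refine Integrable.mono' hi ?_ ?_
  · refine ContinuousOn.aestronglyMeasurable ?_ measurableSet_Ioi
    exact ContinuousOn.smul (by fun_prop) ((hT.continuousOn x).mono Ioi_subset_Ici_self)
  · filter_upwards [ae_restrict_mem measurableSet_Ioi] with s hs
    exact norm_cexp_smul_le (norm_apply_le hb x (le_of_lt hs))

/-- The Laplace transform `x ↦ ∫₀^∞ e^{-zs} T(s) x ds` of a semigroup. -/
noncomputable def laplace (hT : IsC0Semigroup T) (hb : HasGrowthBound T M ω) (hz : ω < z.re) :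
    X →L[ℂ] X :=
  LinearMap.mkContinuous
    { toFun := fun x => ∫ s in Ioi (0 : ℝ), Complex.exp (-z * s) • T s x
      map_add' := fun x y => by
        simp_rw [(T _).map_add, smul_add]
        exact integral_add (hT.integrableOn_cexp_smul hb hz x) (hT.integrableOn_cexp_smul hb hz y)
      map_smul' := fun c x => by
        simp_rw [(T _).map_smul, smul_comm _ c]
        exact integral_smul c _ }
    (M / (z.re - ω)) fun x => by
      refine (norm_integral_cexp_smul_le hz fun s hs => norm_apply_le hb x hs).trans_eq ?_
      ring

theorem laplace_apply (hT : IsC0Semigroup T) (hb : HasGrowthBound T M ω) (hz : ω < z.re) (x : X) :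
    hT.laplace hb hz x = ∫ s in Ioi (0 : ℝ), Complex.exp (-z * s) • T s x := rfl

theorem apply_laplace (hT : IsC0Semigroup T) (hb : HasGrowthBound T M ω) (hz : ω < z.re) (x : X)
    {t : ℝ} (ht : 0 ≤ t) : T t (hT.laplace hb hz x) = hT.laplace hb hz (T t x) := by
  rw [laplace_apply, laplace_apply,
    ← ContinuousLinearMap.integral_comp_comm _ (hT.integrableOn_cexp_smul hb hz x)]
  refine setIntegral_congr_fun measurableSet_Ioi fun s hs => ?_
  simp only [map_smul]
  rw [hT.apply_comm ht (le_of_lt hs)]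

/-- A bound on the whole orbit reproduces itself with `c` divided by `Re z - ω`. Iterating it costs
the factor `M` only once, whereas submultiplicativity would give `M ^ k`. -/
theorem norm_apply_laplace_le (hT : IsC0Semigroup T) (hb : HasGrowthBound T M ω)
    (hz : ω < z.re) {x : X} {c : ℝ} (hx : ∀ t, 0 ≤ t → ‖T t x‖ ≤ c * Real.exp (ω * t)) {t : ℝ}
    (ht : 0 ≤ t) : ‖T t (hT.laplace hb hz x)‖ ≤ c / (z.re - ω) * Real.exp (ω * t) := by
  rw [hT.apply_laplace hb hz x ht, laplace_apply]
  refine (norm_integral_cexp_smul_le (c := c * Real.exp (ω * t)) hz fun s hs => ?_).trans_eq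
    (by ring)
  rw [← hT.apply_add hs ht]
  refine (hx _ (by linarith)).trans_eq ?_
  rw [mul_assoc, ← Real.exp_add]; ring_nf

theorem norm_laplace_pow_le (hT : IsC0Semigroup T) (hb : HasGrowthBound T M ω) (hM : 0 ≤ M)
    (hz : ω < z.re) (k : ℕ) : ‖hT.laplace hb hz ^ k‖ ≤ M / (z.re - ω) ^ k := by
  have hp : 0 < z.re - ω := by linarith
  refine ContinuousLinearMap.opNorm_le_bound _ (by positivity) fun x => ?_
  have key : ∀ t, 0 ≤ t → ‖T t ((hT.laplace hb hz ^ k) x)‖ ≤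
      M * ‖x‖ / (z.re - ω) ^ k * Real.exp (ω * t) := by
    induction k with
    | zero => intro t ht; simpa using norm_apply_le hb x ht
    | succ k ih =>
      intro t ht
      rw [pow_succ']
      refine (hT.norm_apply_laplace_le hb hz ih ht).trans_eq ?_
      rw [pow_succ, div_div]
  have := key 0 le_rfl
  rw [hT.apply_zero, mul_zero, Real.exp_zero, mul_one] at this
  exact this.trans_eq (by ring)

theorem norm_laplace_le (hT : IsC0Semigroup T) (hb : HasGrowthBound T M ω) (hM : 0 ≤ M)
    (hz : ω < z.re) : ‖hT.laplace hb hz‖ ≤ M / (z.re - ω) := by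
  simpa using hT.norm_laplace_pow_le hb hM hz 1

/-- Translation of the integration variable by `h`. The right side depends on `h` only through an
exponential and an integral endpoint, hence is differentiable at `0`. -/
theorem apply_laplace_eq (hT : IsC0Semigroup T) (hb : HasGrowthBound T M ω) (hz : ω < z.re)
    (x : X) {h : ℝ} (hh : 0 ≤ h) :
    T h (hT.laplace hb hz x) = Complex.exp (z * h) • (hT.laplace hb hz x -
      ∫ s in (0 : ℝ)..h, Complex.exp (-z * s) • T (max s 0) x) := by
  have hi := hT.integrableOn_cexp_smul hb hz x
  rw [hT.apply_laplace hb hz x hh, laplace_apply, laplace_apply]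
  have h1 : (∫ s in (0 : ℝ)..h, Complex.exp (-z * s) • T (max s 0) x) =
      ∫ s in (0 : ℝ)..h, Complex.exp (-z * s) • T s x := by
    refine intervalIntegral.integral_congr fun s hs => ?_
    rw [uIcc_of_le hh] at hs
    simp only [max_eq_left hs.1]
  rw [h1, ← intervalIntegral.integral_Ioi_sub_Ioi hi hh, sub_sub_cancel,
    ← (measurePreserving_add_right volume h).setIntegral_preimage_emb
      (measurableEmbedding_addRight h) (fun s : ℝ => Complex.exp (-z * s) • T s x) (Ioi h),
    ← integral_smul]
  have h2 : (fun s : ℝ => s + h) ⁻¹' Ioi h = Ioi 0 := by ext; simp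
  rw [h2]
  refine setIntegral_congr_fun measurableSet_Ioi fun s hs => ?_
  rw [hT.apply_add (le_of_lt hs) hh, smul_smul, ← Complex.exp_add]
  push_cast
  ring_nf

theorem hasGeneratorValue_laplace (hT : IsC0Semigroup T) (hb : HasGrowthBound T M ω)
    (hz : ω < z.re) (x : X) :
    HasGeneratorValue T (hT.laplace hb hz x) (z • hT.laplace hb hz x - x) := by
  set L := hT.laplace hb hz x with hL
  have hc : Continuous fun s : ℝ => Complex.exp (-z * s) • T (max s 0) x :=
    Continuous.smul (by fun_prop) (hT.continuous_max x)
  have hI := (hc.integral_hasStrictDerivAt 0 0).hasDerivAt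
  have he : HasDerivAt (fun h : ℝ => Complex.exp (z * h)) z 0 := by
    have h1 : HasDerivAt (fun h : ℝ => z * (h : ℂ)) z 0 := by
      simpa using (Complex.ofRealCLM.hasDerivAt (x := (0 : ℝ))).const_mul z
    simpa using h1.cexp
  have hd := (he.smul (hI.const_sub L)).hasDerivWithinAt (s := Ioi 0)
  rw [hasDerivWithinAt_iff_tendsto_slope' (by simp)] at hd
  have e : Complex.exp (z * (0 : ℝ)) • -(Complex.exp (-z * (0 : ℝ)) • T (max 0 0) x) +
      z • (L - ∫ s in (0 : ℝ)..0, Complex.exp (-z * s) • T (max s 0) x) = z • L - x := by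
    simp [hT.apply_zero]; abel
  rw [e] at hd
  refine hd.congr' ?_
  filter_upwards [self_mem_nhdsWithin] with h hh
  simp only [slope, vsub_eq_sub, sub_zero, hL]
  rw [hT.apply_laplace_eq hb hz x (le_of_lt hh)]
  simp

/-- The Laplace transform commutes with `T`, hence with the generator; compare with
`hasGeneratorValue_laplace` by uniqueness of limits. -/
theorem laplace_smul_sub (hT : IsC0Semigroup T) (hb : HasGrowthBound T M ω) (hz : ω < z.re)
    {y v : X} (h : HasGeneratorValue T y v) : hT.laplace hb hz (z • y - v) = y := by
  have h1 : HasGeneratorValue T (hT.laplace hb hz y) (hT.laplace hb hz v) := by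
    refine (((hT.laplace hb hz).continuous.tendsto v).comp h).congr' ?_
    filter_upwards [self_mem_nhdsWithin] with s hs
    simp only [Function.comp, ContinuousLinearMap.map_smul_of_tower, map_sub]
    rw [hT.apply_laplace hb hz y (le_of_lt hs)]
  have h2 := tendsto_nhds_unique h1 (hT.hasGeneratorValue_laplace hb hz y)
  rw [map_sub, map_smul, h2, sub_sub_cancel]

/-- The resolvent identity. -/
theorem laplace_laplace (hT : IsC0Semigroup T) (hb : HasGrowthBound T M ω) (hz : ω < z.re)
    {w : ℂ} (hw : ω < w.re) (x : X) :
    hT.laplace hb hw (x - (z - w) • hT.laplace hb hz x) = hT.laplace hb hz x := by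
  have := hT.laplace_smul_sub hb hw (hT.hasGeneratorValue_laplace hb hz x)
  rw [← this]
  congr 1
  rw [this, sub_smul]; abel

theorem denseRange_laplace (hT : IsC0Semigroup T) (hb : HasGrowthBound T M ω) (hz : ω < z.re) :
    DenseRange (hT.laplace hb hz) :=
  by
  refine hT.dense_hasGeneratorValue.mono ?_
  rintro y ⟨v, hv⟩
  exact ⟨_, hT.laplace_smul_sub hb hz hv⟩

end IsC0Semigroup

theorem IsGenerator.hasGeneratorValue_iff {A : X →ₗ.[ℂ] X} {T : ℝ → X →L[ℂ] X}
    (hA : IsGenerator A T) (y v : X) :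
    HasGeneratorValue T y v ↔ ∃ h : y ∈ A.domain, A ⟨y, h⟩ = v := by
  constructor
  · intro h
    have hy : y ∈ A.domain := (hA.mem_domain_iff y).2 ⟨v, h⟩
    exact ⟨hy, tendsto_nhds_unique (hA.tendsto_apply ⟨y, hy⟩) h⟩
  · rintro ⟨h, rfl⟩
    exact hA.tendsto_apply ⟨y, h⟩

theorem IsResolventAt.unique {A : X →ₗ.[ℂ] X} {R S : X →L[ℂ] X} (hR : IsResolventAt A z R)
    (hS : IsResolventAt A z S) : R = S := by
  ext x
  obtain ⟨h, hx⟩ := hR.right_inv x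
  have := hS.left_inv ⟨R x, h⟩
  rw [hx] at this
  exact this.symm

variable [CompleteSpace X]

theorem IsGenerator.isResolventAt_laplace {A : X →ₗ.[ℂ] X} {T : ℝ → X →L[ℂ] X}
    (hA : IsGenerator A T) (hT : IsC0Semigroup T) (hb : HasGrowthBound T M ω) (hz : ω < z.re) :
    IsResolventAt A z (hT.laplace hb hz) where
  right_inv x := by
    obtain ⟨h, hx⟩ := (hA.hasGeneratorValue_iff _ _).1 (hT.hasGeneratorValue_laplace hb hz x)
    exact ⟨h, by rw [hx, sub_sub_cancel]⟩
  left_inv x := hT.laplace_smul_sub hb hz (hA.tendsto_apply x)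

theorem IsGenerator.resolvent_eq_laplace {A : X →ₗ.[ℂ] X} {T : ℝ → X →L[ℂ] X}
    (hA : IsGenerator A T) (hT : IsC0Semigroup T) (hb : HasGrowthBound T M ω) (hz : ω < z.re) :
    resolvent z A = hT.laplace hb hz := by
  have h : ∃ R : X →L[ℂ] X, IsResolventAt A z R := ⟨_, hA.isResolventAt_laplace hT hb hz⟩
  rw [resolvent, dif_pos h]
  exact h.choose_spec.unique (hA.isResolventAt_laplace hT hb hz)

/-- Every semigroup generated by an operator of class `𝒢(M, ω, X)` has the growth bound. -/
theorem IsGenerator.hasGrowthBound {A : X →ₗ.[ℂ] X} {T : ℝ → X →L[ℂ] X}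
    (hA : IsGenerator A T) (hT : IsC0Semigroup T) (h : A ∈ GeneratorClass M ω X) :
    HasGrowthBound T M ω := by
  obtain ⟨-, S, hS, hAS, hb⟩ := h
  intro t ht
  rw [hT.eq_of_generator hS (fun y v hv => (hAS.hasGeneratorValue_iff y v).2
    ((hA.hasGeneratorValue_iff y v).1 hv)) ht]
  exact hb t ht

end Laplace

/-! ### The implicit Euler scheme and its error. -/

section Euler

variable {X : Type*} [NormedAddCommGroup X] [NormedSpace ℂ X] [CompleteSpace X] {M ω : ℝ}
  {T : ℝ → X →L[ℂ] X}

namespace IsC0Semigroup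

/-- The implicit Euler step `(1 - hA)⁻¹ = h⁻¹ R(h⁻¹, A)`. -/
noncomputable def eulerStep (hT : IsC0Semigroup T) (hb : HasGrowthBound T M ω) {h : ℝ}
    (hh : ω < ((h⁻¹ : ℝ) : ℂ).re) : X →L[ℂ] X :=
  h⁻¹ • hT.laplace hb hh

theorem eulerStep_apply_eq (hT : IsC0Semigroup T) (hb : HasGrowthBound T M ω) {h : ℝ}
    (hh : ω < ((h⁻¹ : ℝ) : ℂ).re) (h0 : 0 < h) {y a : X} (hy : HasGeneratorValue T y a) :
    hT.eulerStep hb hh y = y + h • hT.eulerStep hb hh a := by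
  have h1 := hT.laplace_smul_sub hb hh hy
  rw [map_sub, Complex.coe_smul, ContinuousLinearMap.map_smul_of_tower] at h1
  simp only [eulerStep, smul_apply, smul_smul]
  rw [mul_inv_cancel₀ h0.ne', one_smul, ← sub_eq_iff_eq_add, h1]

/-- Using `F y = y + h F A y` twice gives `F y = y + h a + h² F c`, which agrees with the Taylor
expansion of `T h y` up to `O(h²)`. -/
theorem norm_sub_eulerStep_le (hT : IsC0Semigroup T) (hb : HasGrowthBound T M ω) {h : ℝ}
    (hh : ω < ((h⁻¹ : ℝ) : ℂ).re) (h0 : 0 < h) {y a c : X} (hy : HasGeneratorValue T y a)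
    (ha : HasGeneratorValue T a c) {K : ℝ} (hK : ∀ t ∈ Icc (0 : ℝ) h, ‖T t‖ ≤ K)
    (hF : ‖hT.eulerStep hb hh‖ ≤ K) :
    ‖T h y - hT.eulerStep hb hh y‖ ≤ 2 * K * ‖c‖ * h ^ 2 := by
  have e : T h y - hT.eulerStep hb hh y =
      (T h y - y - h • a) - (h * h) • hT.eulerStep hb hh c := by
    rw [hT.eulerStep_apply_eq hb hh h0 hy, hT.eulerStep_apply_eq hb hh h0 ha, smul_add, smul_smul]
    abel
  rw [e]
  refine (norm_sub_le _ _).trans ?_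
  have h1 := hT.norm_taylor_le hy ha h0.le hK
  have h2 : ‖(h * h) • hT.eulerStep hb hh c‖ ≤ (h * h) * (K * ‖c‖) := by
    rw [norm_smul, Real.norm_of_nonneg (by positivity)]
    gcongr
    exact (hT.eulerStep hb hh).le_of_opNorm_le hF c
  calc _ ≤ K * ‖c‖ * h ^ 2 + (h * h) * (K * ‖c‖) := add_le_add h1 h2
    _ = _ := by ring

/-- Telescoping estimate for the iterated implicit Euler scheme. -/
theorem norm_eulerStep_pow_sub_le (hT : IsC0Semigroup T) (hb : HasGrowthBound T M ω) {h : ℝ}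
    (hh : ω < ((h⁻¹ : ℝ) : ℂ).re) (h0 : 0 < h) {y a c : X}
    (hy : HasGeneratorValue T y a) (ha : HasGeneratorValue T a c) {K b : ℝ}
    (hK : ∀ t ∈ Icc (0 : ℝ) (b + 1), ‖T t‖ ≤ K)
    (hF : ∀ j : ℕ, j * h ≤ b + 1 → ‖hT.eulerStep hb hh ^ j‖ ≤ K) (k i : ℕ)
    (hki : (k + i) * h ≤ b) :
    ‖(hT.eulerStep hb hh ^ i) (T (k * h) y - (hT.eulerStep hb hh ^ k) y)‖ ≤
      k * (2 * K ^ 3 * ‖c‖ * h ^ 2) := by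
  -- The prefactor `F ^ i` lets the induction bound whole powers by `K`; peeling off single factors
  -- would accumulate powers of `‖F‖`.
  induction k generalizing i with
  | zero => simp [hT.apply_zero]
  | succ k ih =>
    set F := hT.eulerStep hb hh with hFdef
    push_cast at hki
    have hk0 : 0 ≤ k * h := by positivity
    have hi0 : 0 ≤ i * h := by positivity
    have hb0 : 0 ≤ b := le_trans (by positivity) hki
    have hK0 : 0 ≤ K := (norm_nonneg _).trans (hK 0 ⟨le_rfl, by linarith⟩)
    have e : (F ^ i) (T ((k + 1 : ℕ) * h) y - (F ^ (k + 1)) y) =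
        (F ^ i) (T h (T (k * h) y) - F (T (k * h) y)) +
          (F ^ (i + 1)) (T (k * h) y - (F ^ k) y) := by
      have e1 : ((k + 1 : ℕ) : ℝ) * h = h + k * h := by push_cast; ring
      rw [e1, hT.apply_add h0.le hk0, pow_succ F i, pow_succ' F k]
      simp only [mul_apply_eq_comp, map_sub]
      abel
    rw [e]
    have hTc : ‖T (k * h) c‖ ≤ K * ‖c‖ :=
      (T (k * h)).le_of_opNorm_le (hK _ ⟨hk0, by nlinarith⟩) c
    have hF1 : ‖F‖ ≤ K := by simpa using hF 1 (by simp; linarith)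
    have s1 := hT.norm_sub_eulerStep_le hb hh h0 (hT.hasGeneratorValue_apply hy hk0)
      (hT.hasGeneratorValue_apply ha hk0) (K := K)
      (fun t ht => hK t ⟨ht.1, by linarith [ht.2]⟩) hF1
    have s2 : ‖(F ^ i) (T h (T (k * h) y) - F (T (k * h) y))‖ ≤
        K * (2 * K * (K * ‖c‖) * h ^ 2) := by
      refine ((F ^ i).le_of_opNorm_le (hF i (by nlinarith)) _).trans ?_
      refine mul_le_mul_of_nonneg_left (s1.trans ?_) hK0
      gcongr
    have s3 := ih (i + 1) (by push_cast; linarith)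
    calc _ ≤ K * (2 * K * (K * ‖c‖) * h ^ 2) + k * (2 * K ^ 3 * ‖c‖ * h ^ 2) :=
          (norm_add_le _ _).trans (add_le_add s2 s3)
      _ = _ := by push_cast; ring

/-- Rounding `t` down to the grid costs `O(h)` by Lipschitz continuity; the `k ≤ b / h` local errors
of size `O(h²)` also sum to `O(h)`. -/
theorem norm_sub_eulerStep_pow_floor_le (hT : IsC0Semigroup T) (hb : HasGrowthBound T M ω) {h : ℝ}
    (hh : ω < ((h⁻¹ : ℝ) : ℂ).re) (h0 : 0 < h) {y a c : X}
    (hy : HasGeneratorValue T y a) (ha : HasGeneratorValue T a c) {K b : ℝ}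
    (hK : ∀ t ∈ Icc (0 : ℝ) (b + 1), ‖T t‖ ≤ K)
    (hF : ∀ j : ℕ, j * h ≤ b + 1 → ‖hT.eulerStep hb hh ^ j‖ ≤ K) {t : ℝ} (ht : t ∈ Icc 0 b) :
    ‖T t y - (hT.eulerStep hb hh ^ ⌊t / h⌋₊) y‖ ≤ h * (K * ‖a‖ + b * (2 * K ^ 3 * ‖c‖)) := by
  set k := ⌊t / h⌋₊ with hk
  have hb0 : 0 ≤ b := ht.1.trans ht.2
  have hK0 : 0 ≤ K := (norm_nonneg _).trans (hK 0 ⟨le_rfl, by linarith⟩)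
  have hkt : k * h ≤ t := by
    rw [← le_div_iff₀ h0]; exact Nat.floor_le (div_nonneg ht.1 h0.le)
  have htk : t - k * h ≤ h := by
    have := (div_lt_iff₀ h0).1 (Nat.lt_floor_add_one (t / h))
    rw [← hk] at this
    linarith
  have s1 := hT.norm_apply_sub_apply_le hy (K := K) (s := k * h) (t := t)
    (fun r hr => hK r ⟨hr.1, by linarith [hr.2, ht.2]⟩) (by positivity) hkt
  have s2 := hT.norm_eulerStep_pow_sub_le hb hh h0 hy ha hK hF k 0
    (by simpa using hkt.trans ht.2)
  rw [pow_zero, one_apply_eq_self] at s2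
  calc ‖T t y - (hT.eulerStep hb hh ^ k) y‖
      ≤ ‖T t y - T (k * h) y‖ + ‖T (k * h) y - (hT.eulerStep hb hh ^ k) y‖ :=
        norm_sub_le_norm_sub_add_norm_sub _ _ _
    _ ≤ K * ‖a‖ * h + (k * h) * (2 * K ^ 3 * ‖c‖ * h) := by
        refine add_le_add (s1.trans ?_) (s2.trans_eq (by ring))
        gcongr
    _ ≤ K * ‖a‖ * h + b * (2 * K ^ 3 * ‖c‖ * h) := by
        have := hkt.trans ht.2
        gcongr
    _ = _ := by ring

theorem lt_re_inv {h : ℝ} (h0 : 0 < h) (hω : |ω| * h ≤ 1 / 2) : ω < ((h⁻¹ : ℝ) : ℂ).re := by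
  rw [Complex.ofReal_re, ← one_div, lt_div_iff₀ h0]
  have : ω * h ≤ |ω| * h := by gcongr; exact le_abs_self ω
  linarith

theorem norm_eulerStep_pow_le (hT : IsC0Semigroup T) (hb : HasGrowthBound T M ω) (hM : 0 ≤ M)
    {h : ℝ} (hh : ω < ((h⁻¹ : ℝ) : ℂ).re) (h0 : 0 < h) (hω : |ω| * h ≤ 1 / 2) {B : ℝ} (j : ℕ)
    (hj : j * h ≤ B) : ‖hT.eulerStep hb hh ^ j‖ ≤ M * Real.exp (2 * |ω| * B) := by
  have hp : 0 < h⁻¹ - ω := by simpa using hh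
  have hq : h⁻¹ / (h⁻¹ - ω) ≤ Real.exp (2 * |ω| * h) := by
    have e1 : 2 * |ω| * h + 1 ≤ Real.exp (2 * |ω| * h) := Real.add_one_le_exp _
    have e2 : ω * h ≤ |ω| * h := by gcongr; exact le_abs_self ω
    have e3 : 0 ≤ |ω| * h := by positivity
    rw [div_le_iff₀ hp]
    -- With `u = |ω| h ≤ 1/2`, one has `(1 + 2u)(1 - u) = 1 + u(1 - 2u) ≥ 1`.
    have e4 : 1 ≤ Real.exp (2 * |ω| * h) * (1 - ω * h) := by nlinarith
    calc h⁻¹ = h⁻¹ * 1 := by ring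
      _ ≤ h⁻¹ * (Real.exp (2 * |ω| * h) * (1 - ω * h)) := by gcongr
      _ = _ := by field_simp
  rw [eulerStep, smul_pow, norm_smul, norm_pow, Real.norm_of_nonneg (by positivity)]
  have hL := hT.norm_laplace_pow_le hb hM hh j
  rw [Complex.ofReal_re] at hL
  calc h⁻¹ ^ j * ‖hT.laplace hb hh ^ j‖ ≤ h⁻¹ ^ j * (M / (h⁻¹ - ω) ^ j) := by gcongr
    _ = M * (h⁻¹ / (h⁻¹ - ω)) ^ j := by rw [div_pow]; ring
    _ ≤ M * Real.exp (2 * |ω| * h) ^ j := by gcongr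
    _ = M * Real.exp (2 * |ω| * (j * h)) := by rw [← Real.exp_nat_mul]; ring_nf
    _ ≤ _ := by gcongr

/-- The square of the resolvent maps into the domain of the square of the generator. -/
theorem exists_hasGeneratorValue_laplace_laplace (hT : IsC0Semigroup T)
    (hb : HasGrowthBound T M ω) (hM : 0 ≤ M) {z : ℂ} (hz : ω < z.re) {g : ℝ}
    (hg : M / (z.re - ω) ≤ g) (p : X) :
    ∃ a c, HasGeneratorValue T (hT.laplace hb hz (hT.laplace hb hz p)) a ∧
      HasGeneratorValue T a c ∧ ‖a‖ ≤ g * ((‖z‖ * g + 1) * ‖p‖) ∧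
      ‖c‖ ≤ (‖z‖ * g + 1) * ((‖z‖ * g + 1) * ‖p‖) := by
  set L := hT.laplace hb hz
  have hL : ‖L‖ ≤ g := (hT.norm_laplace_le hb hM hz).trans hg
  have hg0 : 0 ≤ g := (norm_nonneg _).trans hL
  set v := z • L p - p
  have hv : ‖v‖ ≤ (‖z‖ * g + 1) * ‖p‖ := by
    refine (norm_sub_le _ _).trans ?_
    rw [norm_smul]
    have := L.le_of_opNorm_le hL p
    calc _ ≤ ‖z‖ * (g * ‖p‖) + ‖p‖ := by gcongr
      _ = _ := by ring
  have ha : ‖L v‖ ≤ g * ((‖z‖ * g + 1) * ‖p‖) := (L.le_of_opNorm_le hL v).trans (by gcongr)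
  refine ⟨L v, z • L v - v, ?_, hT.hasGeneratorValue_laplace hb hz v, ha, ?_⟩
  · have := hT.hasGeneratorValue_laplace hb hz (L p)
    have e : L v = z • L (L p) - L p := by simp [v]
    rwa [e]
  · refine (norm_sub_le _ _).trans ?_
    rw [norm_smul]
    calc _ ≤ ‖z‖ * (g * ((‖z‖ * g + 1) * ‖p‖)) + (‖z‖ * g + 1) * ‖p‖ := by gcongr
      _ = _ := by ring

end IsC0Semigroup

end Euler

/-! ### Approximating families and their strong limits. -/

/-- A uniformly exponentially bounded family of semigroups `Tn n` on spaces `Xn n` that are linked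
to `X` by uniformly bounded operators `P n : X → Xn n` and `E n : Xn n → X` with `P n ∘ E n = 1`. -/
structure IsApproximation {X : Type*} [NormedAddCommGroup X] [NormedSpace ℂ X]
    {Xn : ℕ → Type*} [∀ n, NormedAddCommGroup (Xn n)] [∀ n, NormedSpace ℂ (Xn n)]
    (P : ∀ n, X →L[ℂ] Xn n) (E : ∀ n, Xn n →L[ℂ] X) (Tn : ∀ n, ℝ → Xn n →L[ℂ] Xn n)
    (p e M ω : ℝ) : Prop where
  norm_P_le : ∀ n, ‖P n‖ ≤ p
  norm_E_le : ∀ n, ‖E n‖ ≤ e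
  P_E : ∀ n x, P n (E n x) = x
  M_nonneg : 0 ≤ M
  semigroup : ∀ n, IsC0Semigroup (Tn n)
  growth : ∀ n, HasGrowthBound (Tn n) M ω

namespace IsApproximation

variable {X : Type*} [NormedAddCommGroup X] [NormedSpace ℂ X]
  {Xn : ℕ → Type*} [∀ n, NormedAddCommGroup (Xn n)] [∀ n, NormedSpace ℂ (Xn n)]
  {P : ∀ n, X →L[ℂ] Xn n} {E : ∀ n, Xn n →L[ℂ] X} {Tn : ∀ n, ℝ → Xn n →L[ℂ] Xn n}
  {p e M ω : ℝ}

theorem p_nonneg (H : IsApproximation P E Tn p e M ω) : 0 ≤ p :=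
  (norm_nonneg _).trans (H.norm_P_le 0)

theorem e_nonneg (H : IsApproximation P E Tn p e M ω) : 0 ≤ e :=
  (norm_nonneg _).trans (H.norm_E_le 0)

theorem norm_conj_le (H : IsApproximation P E Tn p e M ω) {n : ℕ} {F : Xn n →L[ℂ] Xn n} {c : ℝ}
    (hF : ‖F‖ ≤ c) : ‖(E n).comp (F.comp (P n))‖ ≤ e * (c * p) := by
  have hc : 0 ≤ c := (norm_nonneg _).trans hF
  refine (ContinuousLinearMap.opNorm_comp_le _ _).trans ?_
  refine mul_le_mul (H.norm_E_le n) ?_ (norm_nonneg _) H.e_nonneg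
  refine (ContinuousLinearMap.opNorm_comp_le _ _).trans ?_
  exact mul_le_mul hF (H.norm_P_le n) (norm_nonneg _) hc

theorem norm_conj_apply_le (H : IsApproximation P E Tn p e M ω) {n : ℕ} {F : Xn n →L[ℂ] Xn n}
    {c : ℝ} (hF : ‖F‖ ≤ c) (x : X) : ‖E n (F (P n x))‖ ≤ e * (c * p) * ‖x‖ :=
  ((E n).comp (F.comp (P n))).le_of_opNorm_le (H.norm_conj_le hF) x

/-- Used with `u n = E n (G n (P n x))`: since `P n ∘ E n = 1`, strong limits of conjugated
operators multiply. -/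
theorem tendsto_conj_apply (H : IsApproximation P E Tn p e M ω) {F : ∀ n, Xn n →L[ℂ] Xn n}
    {c : ℝ} (hF : ∀ n, ‖F n‖ ≤ c) {u : ℕ → X} {u₀ v : X}
    (h : Tendsto (fun n => E n (F n (P n u₀))) atTop (𝓝 v)) (hu : Tendsto u atTop (𝓝 u₀)) :
    Tendsto (fun n => E n (F n (P n (u n)))) atTop (𝓝 v) :=
  tendsto_apply_of_norm_le (F := fun n => (E n).comp ((F n).comp (P n)))
    (Eventually.of_forall fun n => H.norm_conj_le (hF n)) h hu

theorem norm_le_of_tendsto (H : IsApproximation P E Tn p e M ω) {F : ∀ n, Xn n →L[ℂ] Xn n}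
    {c : ℝ} (hF : ∀ n, ‖F n‖ ≤ c) {R : X →L[ℂ] X}
    (h : ∀ x, Tendsto (fun n => E n (F n (P n x))) atTop (𝓝 (R x))) : ‖R‖ ≤ e * (c * p) := by
  have hc : 0 ≤ c := (norm_nonneg _).trans (hF 0)
  refine R.opNorm_le_bound
    (mul_nonneg H.e_nonneg (mul_nonneg hc H.p_nonneg)) fun x => ?_
  exact le_of_tendsto (h x).norm (Eventually.of_forall fun n => H.norm_conj_apply_le (hF n) x)

theorem hasGrowthBound_of_tendsto (H : IsApproximation P E Tn p e M ω) {T : ℝ → X →L[ℂ] X}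
    (h : ∀ x t, 0 ≤ t → Tendsto (fun n => E n (Tn n t (P n x))) atTop (𝓝 (T t x))) :
    HasGrowthBound T (e * (M * p)) ω := fun t ht =>
  (H.norm_le_of_tendsto (fun n => H.growth n t ht) fun x => h x t ht).trans_eq (by ring)

theorem norm_Tn_le (H : IsApproximation P E Tn p e M ω) (n : ℕ) {t B : ℝ} (ht : 0 ≤ t)
    (hB : t ≤ B) : ‖Tn n t‖ ≤ M * Real.exp (2 * |ω| * B) := by
  refine (H.growth n t ht).trans ?_
  have hM := H.M_nonneg
  have h1 : ω * t ≤ |ω| * B := mul_le_mul (le_abs_self ω) hB ht (abs_nonneg ω)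
  have h2 : 0 ≤ |ω| * B := mul_nonneg (abs_nonneg ω) (ht.trans hB)
  have h3 : ω * t ≤ 2 * |ω| * B := by linarith
  gcongr

/-- The orbit of `x` is, up to `ε` and uniformly on `[0, b]`, eventually independent of `n`. -/
def OrbitApproximable (_ : IsApproximation P E Tn p e M ω) (b : ℝ) (x : X) : Prop :=
  ∀ ε > 0, ∃ g : ℝ → X, ∀ᶠ n in atTop, ∀ t ∈ Icc (0 : ℝ) b, ‖E n (Tn n t (P n x)) - g t‖ ≤ ε

theorem OrbitApproximable.of_dense {H : IsApproximation P E Tn p e M ω} {b : ℝ}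
    {s : Set X} (hs : Dense s) (h : ∀ x ∈ s, H.OrbitApproximable b x) (x : X) :
    H.OrbitApproximable b x := by
  intro ε hε
  have hM := H.M_nonneg
  have he := H.e_nonneg
  have hp := H.p_nonneg
  set B := e * (M * Real.exp (2 * |ω| * b) * p) with hB
  have hB0 : 0 ≤ B := by positivity
  obtain ⟨y, hys, hy⟩ := hs.exists_dist_lt x (ε := ε / 2 / (B + 1)) (by positivity)
  obtain ⟨g, hg⟩ := h y hys (ε / 2) (by positivity)
  refine ⟨g, hg.mono fun n hn t ht => ?_⟩
  have h1 : ‖E n (Tn n t (P n (x - y)))‖ ≤ ε / 2 := by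
    refine (H.norm_conj_apply_le (H.norm_Tn_le n ht.1 ht.2) _).trans ?_
    rw [← dist_eq_norm, ← hB]
    calc B * dist x y ≤ (B + 1) * (ε / 2 / (B + 1)) := by gcongr; linarith
      _ = ε / 2 := by field_simp
  have e1 : E n (Tn n t (P n x)) - g t =
      E n (Tn n t (P n (x - y))) + (E n (Tn n t (P n y)) - g t) := by
    simp only [map_sub]; abel
  rw [e1]
  exact (norm_add_le _ _).trans (by linarith [hn t ht])

theorem OrbitApproximable.uniformCauchySeqOn {H : IsApproximation P E Tn p e M ω} {b : ℝ} {x : X}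
    (h : H.OrbitApproximable b x) :
    UniformCauchySeqOn (fun n t => E n (Tn n t (P n x))) atTop (Icc 0 b) := by
  rw [Metric.uniformCauchySeqOn_iff]
  intro ε hε
  obtain ⟨g, hg⟩ := h (ε / 3) (by positivity)
  obtain ⟨N, hN⟩ := eventually_atTop.1 hg
  refine ⟨N, fun m hm n hn t ht => ?_⟩
  have h1 := hN m hm t ht
  have h2 := hN n hn t ht
  rw [← dist_eq_norm] at h1 h2
  linarith [dist_triangle_right (E m (Tn m t (P m x))) (E n (Tn n t (P n x))) (g t)]

/-! ### Resolvent convergence and convergence of semigroups. -/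

variable [∀ n, CompleteSpace (Xn n)]

theorem norm_laplace_le (H : IsApproximation P E Tn p e M ω) {z : ℂ} (hz : ω < z.re) (n : ℕ) :
    ‖(H.semigroup n).laplace (H.growth n) hz‖ ≤ M / (z.re - ω) :=
  (H.semigroup n).norm_laplace_le (H.growth n) H.M_nonneg hz

/-- Strong convergence of the resolvents at the point `z`. -/
def ResolventConverges (H : IsApproximation P E Tn p e M ω) (z : ℂ) : Prop :=
  ∃ (hz : ω < z.re) (R : X →L[ℂ] X), ∀ x,
    Tendsto (fun n => E n ((H.semigroup n).laplace (H.growth n) hz (P n x))) atTop (𝓝 (R x))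

variable [CompleteSpace X]

/-- Strong convergence of semigroups implies strong convergence of resolvents. -/
theorem tendsto_laplace (H : IsApproximation P E Tn p e M ω) {T : ℝ → X →L[ℂ] X}
    (hT : IsC0Semigroup T) {C : ℝ} (hb : HasGrowthBound T C ω)
    (h : ∀ x t, 0 ≤ t → Tendsto (fun n => E n (Tn n t (P n x))) atTop (𝓝 (T t x))) {z : ℂ}
    (hz : ω < z.re) (x : X) :
    Tendsto (fun n => E n ((H.semigroup n).laplace (H.growth n) hz (P n x))) atTop
      (𝓝 (hT.laplace hb hz x)) := by
  have hint := fun n => (H.semigroup n).integrableOn_cexp_smul (H.growth n) hz (P n x)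
  simp only [IsC0Semigroup.laplace_apply]
  simp_rw [fun n => ((E n).integral_comp_comm (hint n)).symm]
  refine tendsto_integral_of_dominated_convergence
    (fun s => e * (M * p) * ‖x‖ * Real.exp ((ω - z.re) * s))
    (fun n => ((E n).integrable_comp (hint n)).aestronglyMeasurable)
    ((integrableOn_exp_mul_Ioi (by linarith) 0).const_mul _) (fun n => ?_) ?_
  · filter_upwards [ae_restrict_mem measurableSet_Ioi] with s hs
    rw [map_smul]
    exact norm_cexp_smul_le
      ((H.norm_conj_apply_le (H.growth n s (le_of_lt hs)) x).trans_eq (by ring))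
  · filter_upwards [ae_restrict_mem measurableSet_Ioi] with s hs
    simp only [map_smul]
    exact (h x s (le_of_lt hs)).const_smul _

/-- The limit at `w` is `R (1 - (z - w) R)⁻¹`, a Neumann series. The resolvent identity is exact at
the vectors `v n`, which converge to `x`. -/
theorem ResolventConverges.of_dist_lt {H : IsApproximation P E Tn p e M ω} {z w : ℂ}
    (h : H.ResolventConverges z) (hw : ω < w.re)
    (hd : ‖z - w‖ * (e * (M * p)) < z.re - ω) : H.ResolventConverges w := by
  obtain ⟨hz, R, hR⟩ := h
  have hp : 0 < z.re - ω := by linarith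
  have hnR : ‖R‖ ≤ e * (M / (z.re - ω) * p) := H.norm_le_of_tendsto (H.norm_laplace_le hz) hR
  have hlt : ‖(z - w) • R‖ < 1 := by
    rw [norm_smul]
    calc ‖z - w‖ * ‖R‖ ≤ ‖z - w‖ * (e * (M / (z.re - ω) * p)) := by gcongr
      _ = ‖z - w‖ * (e * (M * p)) / (z.re - ω) := by ring
      _ < 1 := by rwa [div_lt_one hp]
  set U := Units.oneSub ((z - w) • R) hlt with hU
  refine ⟨hw, R * ((U⁻¹ : (X →L[ℂ] X)ˣ) : X →L[ℂ] X), fun x => ?_⟩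
  set y := ((U⁻¹ : (X →L[ℂ] X)ˣ) : X →L[ℂ] X) x with hy
  have hx : x = y - (z - w) • R y := by
    have h1 : (U : X →L[ℂ] X) y = x := by
      rw [hy, ← mul_apply_eq_comp, Units.mul_inv]; rfl
    rw [← h1, hU, Units.val_oneSub]; rfl
  set v : ℕ → X := fun n =>
    y - (z - w) • E n ((H.semigroup n).laplace (H.growth n) hz (P n y)) with hv
  have hvx : Tendsto (fun n => x - v n) atTop (𝓝 0) := by
    have : Tendsto v atTop (𝓝 x) := by
      rw [hx]; exact ((hR y).const_smul (z - w)).const_sub y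
    simpa using this.const_sub x
  have h0 := H.tendsto_conj_apply (H.norm_laplace_le hw) (u₀ := 0) (v := 0) (by simp) hvx
  have := h0.add (hR y)
  rw [zero_add] at this
  refine this.congr fun n => ?_
  have e1 : E n ((H.semigroup n).laplace (H.growth n) hw (P n (v n))) =
      E n ((H.semigroup n).laplace (H.growth n) hz (P n y)) := by
    simp only [hv]
    rw [map_sub, map_smul, H.P_E, (H.semigroup n).laplace_laplace (H.growth n) hz hw]
  rw [← e1]
  simp

/-- Strong convergence of the resolvents at one point of the half-plane `Re z > ω` implies strong
convergence at every point. -/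
theorem ResolventConverges.of_lt_re {H : IsApproximation P E Tn p e M ω} {z w : ℂ}
    (h : H.ResolventConverges z) (hw : ω < w.re) : H.ResolventConverges w := by
  -- The convergence set is open and relatively closed: the radius in `of_dist_lt` is proportional
  -- to `Re z - ω`, so it stays away from zero near interior points of the half-plane.
  have hpre : IsPreconnected {w : ℂ | ω < w.re} := (convex_halfSpace_re_gt ω).isPreconnected
  refine hpre.subset_of_closure_inter_subset (u := {z | H.ResolventConverges z}) ?_
    ⟨z, h.1, h⟩ ?_ hw
  · rw [isOpen_iff_mem_nhds]
    intro a ha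
    have o1 : IsOpen {b : ℂ | ω < b.re} := isOpen_lt continuous_const Complex.continuous_re
    have o2 : IsOpen {b : ℂ | ‖a - b‖ * (e * (M * p)) < a.re - ω} :=
      isOpen_lt (by fun_prop) continuous_const
    filter_upwards [o1.mem_nhds ha.1, o2.mem_nhds (by simpa using ha.1)] with b hb hb'
    exact ha.of_dist_lt hb hb'
  · rintro b ⟨hb, hb'⟩
    have o2 : IsOpen {a : ℂ | ‖a - b‖ * (e * (M * p)) < a.re - ω} :=
      isOpen_lt (by fun_prop) (Complex.continuous_re.sub continuous_const)
    obtain ⟨a, ha, ha'⟩ := mem_closure_iff.1 hb _ o2 (by simpa using hb')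
    exact ResolventConverges.of_dist_lt (H := H) ha' hb' ha

/-- Resolvent convergence gives, for every step size, convergence of the Euler scheme. -/
theorem ResolventConverges.exists_tendsto_eulerStep_pow {H : IsApproximation P E Tn p e M ω}
    {z : ℂ} (h : H.ResolventConverges z) {s : ℝ} (hs0 : 0 < s) (hs : ω < ((s⁻¹ : ℝ) : ℂ).re) :
    ∃ Φ : X →L[ℂ] X, ∀ (y : ∀ n, Xn n) (x : X), Tendsto (fun n => E n (y n)) atTop (𝓝 x) →
      ∀ k : ℕ, Tendsto (fun n => E n (((H.semigroup n).eulerStep (H.growth n) hs ^ k) (y n))) atTop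
        (𝓝 ((Φ ^ k) x)) := by
  obtain ⟨_, R, hR⟩ := h.of_lt_re hs
  refine ⟨s⁻¹ • R, fun y x hy k => ?_⟩
  have hΦ : ∀ x, Tendsto (fun n => E n ((H.semigroup n).eulerStep (H.growth n) hs (P n x))) atTop
      (𝓝 ((s⁻¹ • R) x)) := fun x => by
    simp only [IsC0Semigroup.eulerStep, smul_apply, ContinuousLinearMap.map_smul_of_tower]
    exact (hR x).const_smul s⁻¹
  have hbd : ∀ n, ‖(H.semigroup n).eulerStep (H.growth n) hs‖ ≤
      s⁻¹ * (M / (((s⁻¹ : ℝ) : ℂ).re - ω)) := fun n => by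
    rw [IsC0Semigroup.eulerStep, norm_smul, Real.norm_of_nonneg (by positivity)]
    gcongr
    exact H.norm_laplace_le hs n
  induction k with
  | zero => simpa using hy
  | succ k ih =>
    have := H.tendsto_conj_apply hbd (hΦ _) ih
    simpa only [pow_succ', mul_apply_eq_comp, H.P_E] using this

theorem orbitApproximable_sq (H : IsApproximation P E Tn p e M ω) {z : ℂ} (hz : ω < z.re)
    {R : X →L[ℂ] X}
    (hR : ∀ x, Tendsto (fun n => E n ((H.semigroup n).laplace (H.growth n) hz (P n x))) atTop
      (𝓝 (R x))) {b : ℝ} (hb : 0 ≤ b) (x : X) : H.OrbitApproximable b (R (R x)) := by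
  intro ε hε
  have hM := H.M_nonneg
  have he := H.e_nonneg
  have hp := H.p_nonneg
  set g := M / (z.re - ω) with hg
  have hg0 : 0 ≤ g := div_nonneg hM (by linarith)
  set K := M * Real.exp (2 * |ω| * (b + 1)) with hK
  have hK0 : 0 ≤ K := by positivity
  set Q := (‖z‖ * g + 1) * (p * ‖x‖) with hQ
  have hQ0 : 0 ≤ Q := by positivity
  set D := e * (K * (g * Q) + b * (2 * K ^ 3 * ((‖z‖ * g + 1) * Q))) with hD
  have hD0 : 0 ≤ D := by positivity
  -- The step size is fixed before `n`, which is possible because `D` does not depend on `n`.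
  obtain ⟨s, hs0, hsω, hsD⟩ : ∃ s : ℝ, 0 < s ∧ |ω| * s ≤ 1 / 2 ∧ s * D ≤ ε / 3 := by
    have c2 : ∀ᶠ s : ℝ in 𝓝[>] 0, |ω| * s < 1 / 2 := by
      refine mem_nhdsWithin_of_mem_nhds ((isOpen_lt (by fun_prop) continuous_const).mem_nhds ?_)
      simp
    have c3 : ∀ᶠ s : ℝ in 𝓝[>] 0, s * D < ε / 3 := by
      refine mem_nhdsWithin_of_mem_nhds ((isOpen_lt (by fun_prop) continuous_const).mem_nhds ?_)
      simpa using hε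
    obtain ⟨s, h2, h3, h4⟩ := (c2.and (c3.and self_mem_nhdsWithin)).exists
    exact ⟨s, h4, h2.le, h3.le⟩
  have hs := IsC0Semigroup.lt_re_inv hs0 hsω
  have hconv : H.ResolventConverges z := ⟨hz, R, hR⟩
  obtain ⟨Φ, hΦ⟩ := hconv.exists_tendsto_eulerStep_pow hs0 hs
  set L := fun n => (H.semigroup n).laplace (H.growth n) hz with hL
  -- `P n (R (R x))` need not lie in `D(A_n²)`; `y n` does, and `E n (y n) → R (R x)`.
  set y : ∀ n, Xn n := fun n => L n (L n (P n x)) with hy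
  have hyx : Tendsto (fun n => E n (y n)) atTop (𝓝 (R (R x))) := by
    have := H.tendsto_conj_apply (H.norm_laplace_le hz) (hR (R x)) (hR x)
    simpa only [H.P_E] using this
  refine ⟨fun t => (Φ ^ ⌊t / s⌋₊) (R (R x)), ?_⟩
  have ev1 : ∀ᶠ n in atTop, e * (K * p) * ‖R (R x) - E n (y n)‖ < ε / 3 := by
    have : Tendsto (fun n => e * (K * p) * ‖R (R x) - E n (y n)‖) atTop (𝓝 0) := by
      simpa using ((hyx.const_sub (R (R x))).norm).const_mul (e * (K * p))
    exact this.eventually_lt_const (by linarith)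
  have ev2 : ∀ᶠ n in atTop, ∀ k ∈ Finset.range (⌊b / s⌋₊ + 1),
      ‖E n (((H.semigroup n).eulerStep (H.growth n) hs ^ k) (y n)) - (Φ ^ k) (R (R x))‖ < ε / 3 := by
    rw [eventually_all_finset]
    intro k _
    exact (tendsto_iff_norm_sub_tendsto_zero.1 (hΦ y _ hyx k)).eventually_lt_const (by linarith)
  filter_upwards [ev1, ev2] with n h1 h2 t ht
  set k := ⌊t / s⌋₊ with hk
  set F := (H.semigroup n).eulerStep (H.growth n) hs with hF
  have hkb : k ∈ Finset.range (⌊b / s⌋₊ + 1) := by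
    rw [Finset.mem_range, Nat.lt_succ_iff]
    exact Nat.floor_le_floor (by have := ht.2; gcongr)
  obtain ⟨a, c, hya, hac, hna, hnc⟩ :=
    (H.semigroup n).exists_hasGeneratorValue_laplace_laplace (H.growth n) hM hz le_rfl (P n x)
  have hPx : ‖P n x‖ ≤ p * ‖x‖ := (P n).le_of_opNorm_le (H.norm_P_le n) x
  have hna' : ‖a‖ ≤ g * Q := hna.trans (by rw [hQ]; gcongr)
  have hnc' : ‖c‖ ≤ (‖z‖ * g + 1) * Q := hnc.trans (by rw [hQ]; gcongr)
  have s2 := (H.semigroup n).norm_sub_eulerStep_pow_floor_le (H.growth n) hs hs0 hya hac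
    (K := K) (fun t ht => H.norm_Tn_le n ht.1 ht.2)
    (fun j hj => (H.semigroup n).norm_eulerStep_pow_le (H.growth n) hM hs hs0 hsω j hj) ht
  have t1 : ‖E n (Tn n t (P n (R (R x) - E n (y n))))‖ ≤ ε / 3 :=
    (H.norm_conj_apply_le (H.norm_Tn_le n ht.1 (by linarith [ht.2])) _).trans h1.le
  have t2 : ‖E n (Tn n t (y n) - (F ^ k) (y n))‖ ≤ ε / 3 := by
    refine ((E n).le_of_opNorm_le (H.norm_E_le n) _).trans (le_trans ?_ hsD)
    calc e * ‖Tn n t (y n) - (F ^ k) (y n)‖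
        ≤ e * (s * (K * ‖a‖ + b * (2 * K ^ 3 * ‖c‖))) := by gcongr
      _ ≤ e * (s * (K * (g * Q) + b * (2 * K ^ 3 * ((‖z‖ * g + 1) * Q)))) := by gcongr
      _ = s * D := by rw [hD]; ring
  have e1 : E n (Tn n t (P n (R (R x)))) - (Φ ^ k) (R (R x)) =
      E n (Tn n t (P n (R (R x) - E n (y n)))) + E n (Tn n t (y n) - (F ^ k) (y n)) +
        (E n ((F ^ k) (y n)) - (Φ ^ k) (R (R x))) := by
    simp only [map_sub, H.P_E]
    abel
  rw [e1]
  refine (norm_add₃_le).trans ?_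
  linarith [h2 k hkb]

/-- If the resolvents converge strongly at one point to an operator with dense range, then the
semigroups converge strongly and locally uniformly to a semigroup. -/
theorem exists_semigroup_of_tendsto_resolvent (H : IsApproximation P E Tn p e M ω) {z : ℂ}
    (hz : ω < z.re) {R : X →L[ℂ] X} (hdense : DenseRange R)
    (hR : ∀ x, Tendsto (fun n => E n ((H.semigroup n).laplace (H.growth n) hz (P n x))) atTop
      (𝓝 (R x))) :
    ∃ T : ℝ → X →L[ℂ] X, IsC0Semigroup T ∧ ∀ x : X, ∀ b : ℝ,
      TendstoUniformlyOn (fun n t => E n (Tn n t (P n x))) (fun t => T t x) atTop (Icc 0 b) := by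
  have hdense2 : DenseRange (fun x => R (R x)) := hdense.comp hdense R.continuous
  have hcauchy : ∀ x b, 0 ≤ b →
      UniformCauchySeqOn (fun n t => E n (Tn n t (P n x))) atTop (Icc 0 b) := fun x b hb =>
    (OrbitApproximable.of_dense hdense2
      (by rintro _ ⟨w, rfl⟩; exact H.orbitApproximable_sq hz hR hb w) x).uniformCauchySeqOn
  have hlim : ∀ t, 0 ≤ t → ∃ S : X →L[ℂ] X, ∀ x,
      Tendsto (fun n => E n (Tn n t (P n x))) atTop (𝓝 (S x)) := by
    intro t ht
    have hex : ∀ x, ∃ v, Tendsto (fun n => E n (Tn n t (P n x))) atTop (𝓝 v) := fun x =>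
      cauchySeq_tendsto_of_complete ((hcauchy x t ht).cauchySeq ⟨ht, le_rfl⟩)
    choose f hf using hex
    exact ⟨continuousLinearMapOfTendsto (fun n => (E n).comp ((Tn n t).comp (P n)))
      (tendsto_pi_nhds.2 hf), hf⟩
  choose! T hT using hlim
  have hunif : ∀ x : X, ∀ b : ℝ,
      TendstoUniformlyOn (fun n t => E n (Tn n t (P n x))) (fun t => T t x) atTop (Icc 0 b) :=
    fun x b => ((hcauchy x |b| (abs_nonneg b)).tendstoUniformlyOn_of_tendsto
      fun t ht => hT t ht.1 x).mono (Icc_subset_Icc_right (le_abs_self b))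
  -- `E n ∘ P n → 1` is not assumed. It holds on the range of `R` because `E n (P n ·)` fixes `E n
  -- (L_n P n w)`, and dense range does the rest.
  have hT0 : ∀ x, T 0 x = x := by
    refine congrFun (hdense.equalizer (T 0).continuous continuous_id (funext fun w => ?_))
    have := H.tendsto_conj_apply (fun n => H.norm_Tn_le n le_rfl le_rfl) (hT 0 le_rfl (R w)) (hR w)
    simp only [H.P_E, (H.semigroup _).apply_zero] at this
    exact tendsto_nhds_unique this (hR w)
  refine ⟨T, ⟨?_, ?_, ?_⟩, hunif⟩
  · ext x; exact hT0 x
  · intro t s ht hs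
    ext x
    refine tendsto_nhds_unique (hT (t + s) (by linarith) x) ?_
    have := H.tendsto_conj_apply (fun n => H.norm_Tn_le n ht le_rfl) (hT t ht (T s x)) (hT s hs x)
    refine this.congr fun n => ?_
    rw [H.P_E, (H.semigroup n).apply_add ht hs]
  · intro x
    have hc : ContinuousOn (fun t => T t x) (Icc 0 1) :=
      (hunif x 1).continuousOn (Frequently.of_forall fun n =>
        (E n).continuous.comp_continuousOn
          (((H.semigroup n).continuousOn (P n x)).mono fun _ hr => hr.1))
    have h1 := hc 0 ⟨le_rfl, zero_le_one⟩
    rw [ContinuousWithinAt, hT0] at h1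
    refine h1.mono_left ?_
    rw [← nhdsWithin_Ioc_eq_nhdsGT (zero_lt_one' ℝ)]
    exact nhdsWithin_mono _ Ioc_subset_Icc_self

end IsApproximation

end TrotterKato

theorem mainTheorem2
    {X : Type*} [NormedAddCommGroup X] [NormedSpace ℂ X] [CompleteSpace X]
    {Xn : ℕ → Type*} [∀ n, NormedAddCommGroup (Xn n)] [∀ n, NormedSpace ℂ (Xn n)]
    [∀ n, CompleteSpace (Xn n)]
    (P : ∀ n, X →L[ℂ] Xn n) (E : ∀ n, Xn n →L[ℂ] X)
    (hP : BddAbove (Set.range fun n => ‖P n‖)) (hE : BddAbove (Set.range fun n => ‖E n‖))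
    (hPE : ∀ n, (P n).comp (E n) = ContinuousLinearMap.id ℂ (Xn n))
    (M ω : ℝ) (A : ∀ n, Xn n →ₗ.[ℂ] Xn n)
    (hA : ∀ n, A n ∈ TrotterKato.GeneratorClass M ω (Xn n))
    (Tn : ∀ n, ℝ → Xn n →L[ℂ] Xn n)
    (hTn : ∀ n, TrotterKato.IsC0Semigroup (Tn n))
    (hgen : ∀ n, TrotterKato.IsGenerator (A n) (Tn n)) :
    (∃ z₀ : ℂ, ω < z₀.re ∧ (∀ n, z₀ ∈ TrotterKato.resolventSet (A n)) ∧
      ∃ R : X →L[ℂ] X, DenseRange R ∧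
        ∀ x : X, Tendsto (fun n => ‖E n (TrotterKato.resolvent z₀ (A n) (P n x)) - R x‖)
          atTop (𝓝 0)) ↔
    (∃ T : ℝ → X →L[ℂ] X, TrotterKato.IsC0Semigroup T ∧
      ∀ x : X, ∀ b : ℝ, TendstoUniformlyOn (fun n t => E n (Tn n t (P n x)))
        (fun t => T t x) atTop (Set.Icc 0 b)) := by
  obtain ⟨p, hp⟩ := hP
  obtain ⟨e, he⟩ := hE
  have H : TrotterKato.IsApproximation P E Tn p e M ω :=
    { norm_P_le := fun n => hp ⟨n, rfl⟩
      norm_E_le := fun n => he ⟨n, rfl⟩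
      P_E := fun n x => DFunLike.congr_fun (hPE n) x
      M_nonneg := zero_le_one.trans (hA 0).1
      semigroup := hTn
      growth := fun n => (hgen n).hasGrowthBound (hTn n) (hA n) }
  have hres : ∀ {z : ℂ} (hz : ω < z.re) (n : ℕ),
      TrotterKato.resolvent z (A n) = (H.semigroup n).laplace (H.growth n) hz :=
    fun hz n => (hgen n).resolvent_eq_laplace (hTn n) (H.growth n) hz
  constructor
  · rintro ⟨z, hz, -, R, hdense, hR⟩
    refine H.exists_semigroup_of_tendsto_resolvent hz hdense fun x => ?_
    simpa only [hres hz] using tendsto_iff_norm_sub_tendsto_zero.2 (hR x)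
  · rintro ⟨T, hT, hlim⟩
    have hpt : ∀ x t, 0 ≤ t → Tendsto (fun n => E n (Tn n t (P n x))) atTop (𝓝 (T t x)) :=
      fun x t ht => (hlim x t).tendsto_at ⟨ht, le_rfl⟩
    have hb := H.hasGrowthBound_of_tendsto hpt
    -- Any point of the half-plane would serve as `λ₀`.
    have hz : ω < ((ω + 1 : ℝ) : ℂ).re := by simp
    refine ⟨((ω + 1 : ℝ) : ℂ), hz,
      fun n => ⟨_, (hgen n).isResolventAt_laplace (hTn n) (H.growth n) hz⟩,
      hT.laplace hb hz, hT.denseRange_laplace hb hz, fun x => ?_⟩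
    simpa only [hres hz] using tendsto_iff_norm_sub_tendsto_zero.1 (H.tendsto_laplace hT hb hpt hz x)
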